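/- Let $k$ be an arbitrary field, $n\ge 1$, $R=k[X_0,\dots,X_n]$, and let $\mathfrak F\colon\mathbb P^n_k\dashrightarrow\mathbb P^n_k$ be the rational map given by an ordered tuple $\mathbf f=(f_0,\dots,f_n)$ of forms in $R$ of one and the same degree $d\ge 1$ which are linearly independent over $k$. Assume that the base ideal $I=(f_0,\dots,f_n)\subset R$ is of linear type, i.e. that the natural surjection $\mathcal S_R(I)\to\mathcal R_R(I)$ from the symmetric algebra to the Rees algebra is injective. Let $\phi_1$ be a linear syzygy matrix of $\mathbf f$, that is, a matrix over $R$ with $n+1$ rows whose columns span the $k$-vector space of all $(a_0,\dots,a_n)\in R^{n+1}$ such that every $a_j$ is zero or a linear form and $\sum_j a_jf_j=0$. Then the following conditions are equivalent: (a) $\mathfrak F$ is a Cremona transformation, i.e. $f_0,\dots,f_n$ are algebraically independent over $k$ (the image is $\mathbb P^n$) and there are forms $g_0,\dots,g_n\in k[Y_0,\dots,Y_n]$ of one degree $\ge 1$, not all zero, such that $(g_0(\mathbf f),\dots,g_n(\mathbf f))$ is proportional to $(X_0,\dots,X_n)$ by a nonzero homogeneous fraction; (b) $\phi_1$ has rank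 $n$. Moreover, if these conditions hold, the inverse map $\mathfrak F^{-1}$ has degree $\le n$: whatever tuple $\mathbf g$ as in (a) represents it, it is also given, up to proportionality by a nonzero homogeneous fraction, by forms of a single degree $r$, with $1\le r\le n$, generating an ideal of codimension $\ge 2$. -/

import Mathlib

open MvPolynomial

/-- The canonical `R`-linear map `I → R_R(I) = ⨁ Iʲ tʲ`, `x ↦ x t`, identifying `I` with the
degree one part of its Rees algebra. -/
noncomputable def Ideal.toReesAlgebra {R : Type*} [CommRing R] (I : Ideal R) :
    I →ₗ[R] reesAlgebra I where
  toFun x := ⟨Polynomial.monomial 1 (x : R), reesAlgebra.monomial_mem.mpr (by simp)⟩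
  map_add' x y := by ext1; simp
  map_smul' r x := by ext1; simp [Polynomial.smul_monomial]

/-- An ideal is of linear type if the natural (surjective) `R`-algebra homomorphism from its
symmetric algebra to its Rees algebra is injective. -/
def Ideal.IsLinearType {R : Type*} [CommRing R] (I : Ideal R) : Prop :=
  Function.Injective (SymmetricAlgebra.lift I.toReesAlgebra)

namespace RationalMap

variable {k : Type*} [Field k] {n m : ℕ}

/-- A representative of degree `d` of a rational map `ℙⁿ ⇢ ℙᵐ`: an ordered tuple of `m + 1` forms
of the same degree `d ≥ 1` in `k[X₀, …, Xₙ]`, whose ideal contains a regular element. (As the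
polynomial ring is a domain, the latter says that the tuple is nonzero, and the ring is
automatically torsion-free over the subalgebra generated by the forms.) -/
structure IsDatum (f : Fin (m + 1) → MvPolynomial (Fin (n + 1)) k) (d : ℕ) : Prop where
  one_le_degree : 1 ≤ d
  isHomogeneous : ∀ j, (f j).IsHomogeneous d
  exists_ne_zero : ∃ j, f j ≠ 0

/-- Two tuples define the same rational map if they are proportional through a nonzero
homogeneous fraction. -/
def Equivalent (f f' : Fin (m + 1) → MvPolynomial (Fin (n + 1)) k) : Prop :=
  ∃ (F F' : MvPolynomial (Fin (n + 1)) k) (a b : ℕ), F.IsHomogeneous a ∧ F'.IsHomogeneous b ∧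
    F ≠ 0 ∧ F' ≠ 0 ∧ ∀ j, F * f' j = F' * f j

/-- The base ideal of the map, for the given representative. -/
noncomputable def baseIdeal (f : Fin (m + 1) → MvPolynomial (Fin (n + 1)) k) :
    Ideal (MvPolynomial (Fin (n + 1)) k) :=
  Ideal.span (Set.range f)

/-- The composite `g(f) = (g₀(f), …, gᵣ(f))`. -/
noncomputable def comp {r : ℕ} (g : Fin (r + 1) → MvPolynomial (Fin (m + 1)) k)
    (f : Fin (m + 1) → MvPolynomial (Fin (n + 1)) k) :
    Fin (r + 1) → MvPolynomial (Fin (n + 1)) k :=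
  fun i => aeval f (g i)

/-- The rational map `ℙⁿ ⇢ ℙᵐ` is dominant: the homogeneous coordinate ring `k[Y] / 𝔟 ≃ k[f]` of
its image is the whole of `k[Y]`, that is, `f` satisfies no polynomial relation over `k`. -/
def IsDominant (f : Fin (m + 1) → MvPolynomial (Fin (n + 1)) k) : Prop :=
  AlgebraicIndependent k f

/-- `g` is a representative of a rational map inverse to the one defined by the dominant `f`:
the composite `g(f)` is equivalent to the identity `(X₀ : ⋯ : Xₙ)`. -/
def IsInverse (f g : Fin (n + 1) → MvPolynomial (Fin (n + 1)) k) : Prop :=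
  (∃ e, IsDatum g e) ∧ Equivalent (comp g f) X

/-- A Cremona transformation: a birational map of `ℙⁿ` onto `ℙⁿ`. -/
def IsCremona (f : Fin (n + 1) → MvPolynomial (Fin (n + 1)) k) : Prop :=
  IsDominant f ∧ ∃ g, IsInverse f g

/-- The map represented by `g` has degree `r`: it is defined by forms of degree `r` that generate
an ideal of codimension at least two. -/
def HasDegree (g : Fin (m + 1) → MvPolynomial (Fin (n + 1)) k) (r : ℕ) : Prop :=
  ∃ g', IsDatum g' r ∧ Equivalent g g' ∧ 2 ≤ (baseIdeal g').height

/-- The `k`-space of linear syzygies of `f`: the vectors of linear forms `a` with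
`∑ j, a j * f j = 0`. -/
def linearSyzygies (f : Fin (m + 1) → MvPolynomial (Fin (n + 1)) k) :
    Submodule k (Fin (m + 1) → MvPolynomial (Fin (n + 1)) k) where
  carrier := {a | (∀ j, (a j).IsHomogeneous 1) ∧ ∑ j, a j * f j = 0}
  add_mem' {a b} ha hb := ⟨fun j => (ha.1 j).add (hb.1 j), by
    simp [add_mul, Finset.sum_add_distrib, ha.2, hb.2]⟩
  zero_mem' := ⟨fun _ => isHomogeneous_zero _ _ _, by simp⟩
  smul_mem' c a ha := ⟨fun j => (homogeneousSubmodule _ k 1).smul_mem c (ha.1 j), by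
    simp [← Finset.smul_sum, ha.2]⟩

/-- `φ₁` is a linear syzygy matrix of `f`: its columns generate the linear part of the first
syzygy module of `f`. -/
def IsLinearSyzygyMatrix (f : Fin (m + 1) → MvPolynomial (Fin (n + 1)) k) {s : ℕ}
    (φ₁ : Matrix (Fin (m + 1)) (Fin s) (MvPolynomial (Fin (n + 1)) k)) : Prop :=
  Submodule.span k (Set.range φ₁.col) = linearSyzygies f

/-- Every tuple has a linear syzygy matrix. -/
theorem exists_isLinearSyzygyMatrix (f : Fin (m + 1) → MvPolynomial (Fin (n + 1)) k) :
    ∃ (s : ℕ) (φ₁ : Matrix (Fin (m + 1)) (Fin s) (MvPolynomial (Fin (n + 1)) k)),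
      IsLinearSyzygyMatrix f φ₁ := by
  have hfg : (Submodule.span k (Set.range (X : Fin (n + 1) → MvPolynomial (Fin (n + 1)) k))).FG :=
    Submodule.fg_span (Set.finite_range _)
  have h1 : homogeneousSubmodule (Fin (n + 1)) k 1 =
      Submodule.span k (Set.range (X : Fin (n + 1) → MvPolynomial (Fin (n + 1)) k)) :=
    homogeneousSubmodule_one_eq_span_X
  have hfin : (Submodule.pi Set.univ
      (fun _ : Fin (m + 1) => homogeneousSubmodule (Fin (n + 1)) k 1)).FG :=
    Submodule.fg_pi fun _ => h1 ▸ hfg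
  have hle : linearSyzygies f ≤ Submodule.pi Set.univ
      (fun _ : Fin (m + 1) => homogeneousSubmodule (Fin (n + 1)) k 1) :=
    fun a ha j _ => ha.1 j
  have : (linearSyzygies f).FG := by
    have : IsNoetherian k (Submodule.pi Set.univ
        (fun _ : Fin (m + 1) => homogeneousSubmodule (Fin (n + 1)) k 1)) :=
      isNoetherian_of_fg_of_noetherian _ hfin
    exact isNoetherian_submodule.mp this _ hle
  obtain ⟨s, v, hv⟩ := Submodule.fg_iff_exists_fin_generating_family.mp this
  exact ⟨s, Matrix.of fun i j => v j i, hv⟩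

end RationalMap

/-! Linear type means that every form relation P(Y) with P(f) = 0 follows from the syzygies of f. So
P vanishes at any pair (σ, y), with σ a specialization of R and y a tuple, that kills the syzygies
(`Ideal.IsLinearType.eval₂_eq_zero`). If σ also kills all products of two variables, it suffices to
kill the linear syzygies: linear independence of f removes the constant part of a syzygy
(`eval₂_eq_zero_of_isLinearType`). Taking σ to be evaluation at 0 makes f algebraically independent.

Let ψ be the Jacobian dual of φ₁ evaluated at f, so that X ψ = f φ₁ = 0. If g inverts f and w ψ = 0,
specializing X to εw over the dual numbers in X_i g_j(Y) - X_j g_i(Y) makes w proportional to g(f)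
(`mul_eq_mul_of_isLinearType`). Hence the left kernel of ψ has rank at most one. Differentiating φ₁
v = 0 gives ψ v = 0, so ψ has no more independent columns than φ₁, and the rank of φ₁ is at least n.
It is at most n because f φ₁ = 0 (`rank_lt_of_vecMul_eq_zero`).

Conversely, n independent columns of φ₁ have a Jacobian dual over k[Y] with zero kernel, by a second
differentiation and algebraic independence. Its maximal minors are forms of degree n, not all zero,
and at f they are proportional to X (`exists_isDatum_of_rank_eq`). Only the Leibniz rule is used, so
the characteristic is irrelevant. A representative of least degree has no common prime factor, hence
codimension at least two (`exists_hasDegree_le`). -/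

namespace MvPolynomial

/-! ### Homogeneous components and linear forms -/

/-- Substituting `f j * t` into a form of degree `e` pulls out the factor `t ^ e`. -/
theorem IsHomogeneous.aeval_monomial_one {R ι : Type*} [CommRing R] {P : MvPolynomial ι R} {e : ℕ}
    (hP : P.IsHomogeneous e) (f : ι → R) :
    MvPolynomial.aeval (fun j => Polynomial.monomial 1 (f j)) P =
      Polynomial.monomial e (MvPolynomial.aeval f P) := by
  rw [P.as_sum, map_sum, map_sum, map_sum]
  refine Finset.sum_congr rfl fun d hd => ?_
  rw [aeval_monomial, aeval_monomial, Finsupp.prod, Finsupp.prod]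
  have hde : ∑ i ∈ d.support, d i = e := by
    rw [hP.degree_eq_sum_deg_support hd]
  have : ∏ i ∈ d.support, (Polynomial.monomial 1 (f i)) ^ d i =
      Polynomial.monomial e (∏ i ∈ d.support, f i ^ d i) := by
    simp_rw [← Polynomial.C_mul_X_eq_monomial, mul_pow, Finset.prod_mul_distrib,
      Finset.prod_pow_eq_pow_sum, hde, ← Polynomial.C_mul_X_pow_eq_monomial, map_prod, map_pow]
  rw [this, Polynomial.algebraMap_apply, ← Polynomial.C_mul_monomial]

theorem homogeneousComponent_add_mul {R ι : Type*} [CommRing R] (p : MvPolynomial ι R)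
    {q : MvPolynomial ι R} {d : ℕ} (hq : q.IsHomogeneous d) (e : ℕ) :
    homogeneousComponent (e + d) (p * q) = homogeneousComponent e p * q := by
  have h (i : ℕ) : homogeneousComponent (e + d) (homogeneousComponent i p * q) =
      if i = e then homogeneousComponent e p * q else 0 := by
    rw [homogeneousComponent_of_mem ((homogeneousComponent_isHomogeneous i p).mul hq)]
    split_ifs with h1 h2 h2 <;> first | omega | simp_all
  conv_lhs => rw [← sum_homogeneousComponent p]
  rw [Finset.sum_mul, map_sum, Finset.sum_congr rfl fun i _ => h i, Finset.sum_ite_eq']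
  split_ifs with he
  · rfl
  · rw [homogeneousComponent_eq_zero, zero_mul]
    simpa using he

/-- A homomorphism killing the squares of the variables sees only the terms of degree at most
one. -/
theorem map_eq_of_map_X_mul_X_eq_zero {k ι Q : Type*} [CommRing k] [CommRing Q] [Algebra k Q]
    (σ : MvPolynomial ι k →ₐ[k] Q) (hσ : ∀ i j, σ (X i) * σ (X j) = 0) (p : MvPolynomial ι k) :
    σ p = algebraMap k Q (coeff 0 p) + σ (homogeneousComponent 1 p) := by
  classical
  induction p using MvPolynomial.induction_on' with
  | add p q hp hq => rw [map_add, hp, hq, map_add, coeff_add, map_add, map_add]; ring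
  | monomial d c =>
    have hm := homogeneousComponent_of_mem (m := 1)
      (isHomogeneous_monomial (σ := ι) c (rfl : d.degree = d.degree))
    rcases eq_or_ne d 0 with rfl | hd
    · rw [hm, coeff_monomial]
      simp only [map_zero, if_true, one_ne_zero, if_false, add_zero]
      exact σ.commutes c
    rw [coeff_monomial, if_neg hd, map_zero, zero_add, hm]
    split_ifs with h1
    · rfl
    -- The degree is neither 0 nor 1, so two variables can be split off the monomial.
    · obtain ⟨i, hi⟩ := Finsupp.ne_iff.mp hd
      obtain ⟨d', rfl⟩ : ∃ d', d = Finsupp.single i 1 + d' :=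
        ⟨d - Finsupp.single i 1, by
          rw [add_tsub_cancel_of_le]
          simpa [Nat.one_le_iff_ne_zero] using hi⟩
      have hd' : d' ≠ 0 := by
        rintro rfl
        simp at h1
      obtain ⟨j, hj⟩ := Finsupp.ne_iff.mp hd'
      obtain ⟨d'', rfl⟩ : ∃ d'', d' = Finsupp.single j 1 + d'' :=
        ⟨d' - Finsupp.single j 1, by
          rw [add_tsub_cancel_of_le]
          simpa [Nat.one_le_iff_ne_zero] using hj⟩
      rw [show monomial (Finsupp.single i 1 + (Finsupp.single j 1 + d'')) c =
        X i * X j * monomial d'' c by simp [X, monomial_mul, add_assoc], map_mul, map_mul, hσ,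
        zero_mul, map_zero]

theorem IsHomogeneous.eq_sum_C_mul_X {R ι : Type*} [CommRing R] [Fintype ι] {p : MvPolynomial ι R}
    (hp : p.IsHomogeneous 1) : p = ∑ i, C (coeff (Finsupp.single i 1) p) * X i := by
  classical
  have h : p ∈ homogeneousSubmodule ι R 1 := hp
  rw [homogeneousSubmodule_one_eq_span_X, Submodule.mem_span_range_iff_exists_fun] at h
  obtain ⟨c, rfl⟩ := h
  refine Finset.sum_congr rfl fun i _ => ?_
  rw [smul_eq_C_mul, coeff_sum]
  simp [coeff_X, Finsupp.single_left_inj]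

end MvPolynomial

/-! ### Linear type as a specialization principle -/

/-- If the ideal generated by `f` is of linear type, every homogeneous polynomial relation of `f`
holds for each family `y`, over any ring, which satisfies the linear relations of `f`. -/
theorem Ideal.IsLinearType.eval₂_eq_zero {R Q ι : Type*} [CommRing R] [CommRing Q] [Fintype ι]
    {f : ι → R} (h : (Ideal.span (Set.range f)).IsLinearType) (σ : R →+* Q) (y : ι → Q)
    (hy : ∀ a : ι → R, ∑ j, a j * f j = 0 → ∑ j, σ (a j) * y j = 0)
    {P : MvPolynomial ι R} {e : ℕ} (hP : P.IsHomogeneous e) (hPf : aeval f P = 0) :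
    eval₂ σ y P = 0 := by
  let _ := σ.toAlgebra
  set I := Ideal.span (Set.range f) with hI
  have hr : LinearMap.range (Fintype.linearCombination R f) = I := by
    rw [Fintype.range_linearCombination]
  let p : (ι → R) →ₗ[R] I := (Fintype.linearCombination R f).codRestrict I
    fun a => hr ▸ LinearMap.mem_range_self _ a
  have hp : Function.Surjective p := by
    rintro ⟨x, hx⟩
    obtain ⟨a, rfl⟩ := hr.symm ▸ hx
    exact ⟨a, rfl⟩
  let q : (ι → R) →ₗ[R] Q := Fintype.linearCombination R y
  -- The hypothesis on `y` is exactly what lets `f j ↦ y j` descend to a linear map `l` on the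
  -- ideal, and then to its symmetric algebra.
  have hpq : LinearMap.ker p ≤ LinearMap.ker q := by
    intro a ha
    have h0 : ∑ j, a j * f j = 0 := by
      have := congrArg Subtype.val (LinearMap.mem_ker.mp ha)
      simpa [p, Fintype.linearCombination_apply] using this
    rw [LinearMap.mem_ker]
    simp only [q, Fintype.linearCombination_apply, Algebra.smul_def]
    exact hy a h0
  let l : I →ₗ[R] Q := (LinearMap.ker p).liftQ q hpq ∘ₗ (p.quotKerEquivOfSurjective hp).symm
  have hl (a) : l (p a) = q a := by
    have : (p.quotKerEquivOfSurjective hp).symm (p a) = Submodule.Quotient.mk a := by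
      rw [LinearEquiv.symm_apply_eq]; rfl
    simp [l, this]
  let F : ι → I := fun j => ⟨f j, Ideal.subset_span (Set.mem_range_self j)⟩
  have hlF (j) : l (F j) = y j := by
    classical
    have : F j = p (Pi.single j 1) := by
      ext1
      simp [F, p]
    rw [this, hl]
    simp [q]
  let Φ : MvPolynomial ι R →ₐ[R] SymmetricAlgebra R I :=
    aeval fun j => SymmetricAlgebra.ι R I (F j)
  -- In the Rees algebra the image of `P` is P(f) t^e, which is zero.
  have h1 : SymmetricAlgebra.lift I.toReesAlgebra (Φ P) = 0 := by
    have : ((reesAlgebra I).val.comp ((SymmetricAlgebra.lift I.toReesAlgebra).comp Φ)) =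
        aeval fun j => Polynomial.monomial 1 (f j) := by
      ext j
      simp [Φ, F, Ideal.toReesAlgebra]
    have h2 := DFunLike.congr_fun this P
    rw [MvPolynomial.IsHomogeneous.aeval_monomial_one hP, hPf, map_zero] at h2
    exact Subtype.ext h2
  have h2 : Φ P = 0 := h (h1.trans (map_zero _).symm)
  have h3 : (SymmetricAlgebra.lift l).comp Φ = aeval y := by
    ext j
    simp [Φ, hlF]
  have h4 := DFunLike.congr_fun h3 P
  rw [AlgHom.comp_apply, h2, map_zero] at h4
  exact h4.symm

/-! ### Specializations that see only the linear syzygies -/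

namespace RationalMap

variable {k : Type*} [Field k] {n m : ℕ}

/-- Modulo the squares of the variables, only the linear syzygies matter. -/
theorem sum_map_mul_eq_zero_of_linearSyzygies {Q : Type*} [CommRing Q] [Algebra k Q]
    {f : Fin (m + 1) → MvPolynomial (Fin (n + 1)) k} {d : ℕ} (hf : ∀ j, (f j).IsHomogeneous d)
    (hmin : LinearIndependent k f) (σ : MvPolynomial (Fin (n + 1)) k →ₐ[k] Q)
    (hσ : ∀ i j, σ (X i) * σ (X j) = 0) (y : Fin (m + 1) → Q)
    (hy : ∀ a ∈ linearSyzygies f, ∑ j, σ (a j) * y j = 0)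
    (a : Fin (m + 1) → MvPolynomial (Fin (n + 1)) k) (ha : ∑ j, a j * f j = 0) :
    ∑ j, σ (a j) * y j = 0 := by
  have hc (e : ℕ) : ∑ j, homogeneousComponent e (a j) * f j = 0 := by
    have := congrArg (homogeneousComponent (e + d)) ha
    rw [map_sum, map_zero] at this
    rw [← this]
    exact Finset.sum_congr rfl fun j _ => (homogeneousComponent_add_mul _ (hf j) e).symm
  -- The degree-zero part of a syzygy is a relation over `k`, excluded by linear independence.
  have h0 (j) : coeff 0 (a j) = 0 := by
    refine Fintype.linearIndependent_iff.mp hmin (fun j => coeff 0 (a j)) ?_ j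
    rw [← hc 0]
    simp [homogeneousComponent_zero, smul_eq_C_mul]
  rw [← hy (fun j => homogeneousComponent 1 (a j))
    ⟨fun j => homogeneousComponent_isHomogeneous _ _, hc 1⟩]
  refine Finset.sum_congr rfl fun j _ => ?_
  rw [map_eq_of_map_X_mul_X_eq_zero σ hσ (a j), h0, map_zero, zero_add]

/-- Linear type reduces the vanishing of `P` to all syzygies, and the condition on `σ` reduces these
to the linear ones. Both applications below choose `σ` and `y` here. -/
theorem eval₂_eq_zero_of_isLinearType {Q : Type*} [CommRing Q] [Algebra k Q]
    {f : Fin (m + 1) → MvPolynomial (Fin (n + 1)) k} {d : ℕ} (hf : ∀ j, (f j).IsHomogeneous d)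
    (hmin : LinearIndependent k f) (hI : (baseIdeal f).IsLinearType)
    (σ : MvPolynomial (Fin (n + 1)) k →ₐ[k] Q) (hσ : ∀ i j, σ (X i) * σ (X j) = 0)
    (y : Fin (m + 1) → Q) (hy : ∀ a ∈ linearSyzygies f, ∑ j, σ (a j) * y j = 0)
    {P : MvPolynomial (Fin (m + 1)) (MvPolynomial (Fin (n + 1)) k)} {e : ℕ}
    (hP : P.IsHomogeneous e) (hPf : aeval f P = 0) :
    eval₂ σ.toRingHom y P = 0 :=
  hI.eval₂_eq_zero _ y (sum_map_mul_eq_zero_of_linearSyzygies hf hmin σ hσ y hy) hP hPf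

theorem eval₂_map_C {Q : Type*} [CommRing Q] [Algebra k Q]
    (σ : MvPolynomial (Fin (n + 1)) k →ₐ[k] Q) (y : Fin (m + 1) → Q)
    (p : MvPolynomial (Fin (m + 1)) k) :
    eval₂ σ.toRingHom y (map C p) = aeval y p := by
  rw [eval₂_map, aeval_def]
  congr 1
  exact RingHom.ext fun c => σ.commutes c

theorem aeval_map_C (f : Fin (m + 1) → MvPolynomial (Fin (n + 1)) k)
    (p : MvPolynomial (Fin (m + 1)) k) :
    aeval f (map C p : MvPolynomial _ (MvPolynomial (Fin (n + 1)) k)) = aeval f p :=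
  aeval_map_algebraMap (MvPolynomial (Fin (n + 1)) k) f p

/-- Linearly independent forms of the same positive degree generating an ideal of linear type are
algebraically independent. -/
theorem algebraicIndependent_of_isLinearType {f : Fin (m + 1) → MvPolynomial (Fin (n + 1)) k}
    {d : ℕ} (hf : IsDatum f d) (hmin : LinearIndependent k f) (hI : (baseIdeal f).IsLinearType) :
    AlgebraicIndependent k f := by
  rw [algebraicIndependent_iff]
  intro P hP
  -- Since `d` is positive, the parts of `P` of different degrees land in different degrees d e
  -- after substitution.
  have hcomp (e : ℕ) : aeval f (homogeneousComponent e P) = 0 := by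
    have hi (i : ℕ) : homogeneousComponent (d * e) (aeval f (homogeneousComponent i P)) =
        if i = e then aeval f (homogeneousComponent e P) else 0 := by
      rw [homogeneousComponent_of_mem ((homogeneousComponent_isHomogeneous i P).aeval f
        hf.isHomogeneous)]
      have : d * e = d * i ↔ i = e :=
        (Nat.mul_right_inj (by have := hf.one_le_degree; omega)).trans eq_comm
      simp only [this]
      split_ifs with h1
      · rw [h1]
      · rfl
    have := congrArg (homogeneousComponent (d * e)) hP
    rw [← sum_homogeneousComponent P, map_sum, map_sum, Finset.sum_congr rfl fun i _ => hi i,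
      Finset.sum_ite_eq', map_zero] at this
    split_ifs at this with he
    · exact this
    · rw [homogeneousComponent_eq_zero, map_zero]
      simpa using he
  have hz (e : ℕ) : homogeneousComponent e P = 0 := by
    have h1 (a : MvPolynomial (Fin (n + 1)) k) (ha : a.IsHomogeneous 1) :
        (aeval 0 : _ →ₐ[k] MvPolynomial (Fin (m + 1)) k) a = 0 := by
      rw [aeval_zero, constantCoeff_eq, ha.coeff_eq_zero (by simp), map_zero]
    -- Evaluation at the origin kills all linear forms, so `y` is unconstrained and may be the
    -- generic point.
    have := eval₂_eq_zero_of_isLinearType hf.isHomogeneous hmin hI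
      (aeval 0 : _ →ₐ[k] MvPolynomial (Fin (m + 1)) k) (by simp) X
      (fun a ha => Finset.sum_eq_zero fun j _ => by rw [h1 _ (ha.1 j), zero_mul])
      ((homogeneousComponent_isHomogeneous e P).map C) (by rw [aeval_map_C, hcomp])
    rwa [eval₂_map_C, aeval_X_left_apply] at this
  rw [← sum_homogeneousComponent P]
  exact Finset.sum_eq_zero fun e _ => hz e

/-- A vector orthogonal to the Jacobian dual matrix, evaluated at `f`, is proportional to every
tuple of forms in `f` that is proportional to the variables. This version uses an abstract
first-order thickening `Q` of the polynomial ring. -/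
theorem mul_eq_mul_of_thickening {Q : Type*} [CommRing Q] [Algebra k Q]
    {f : Fin (n + 1) → MvPolynomial (Fin (n + 1)) k} {d : ℕ}
    (hf : ∀ j, (f j).IsHomogeneous d) (hmin : LinearIndependent k f)
    (hI : (baseIdeal f).IsLinearType)
    (τ : MvPolynomial (Fin (n + 1)) k →ₐ[k] Q) (ε : Q) (hε : ε * ε = 0)
    (hτ : ∀ p, ε * τ p = 0 → p = 0)
    (w : Fin (n + 1) → MvPolynomial (Fin (n + 1)) k)
    (hw : ∀ a ∈ linearSyzygies f,
      ∑ j, (∑ i, C (coeff (Finsupp.single i 1) (a j)) * w i) * f j = 0)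
    {g : Fin (n + 1) → MvPolynomial (Fin (n + 1)) k} {e : ℕ} (hg : ∀ i, (g i).IsHomogeneous e)
    (hgX : ∀ i j, X i * aeval f (g j) = X j * aeval f (g i)) (i j : Fin (n + 1)) :
    w i * aeval f (g j) = w j * aeval f (g i) := by
  obtain ⟨σ, hσ⟩ : ∃ σ : MvPolynomial (Fin (n + 1)) k →ₐ[k] Q, ∀ i, σ (X i) = ε * τ (w i) :=
    ⟨aeval fun i => ε * τ (w i), fun i => by simp⟩
  -- The relation X_i g_j(Y) - X_j g_i(Y) is specialized at X = εw, Y = f. Products of two variables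
  -- die since ε² = 0, and linear syzygies die by `hw`.
  have key := eval₂_eq_zero_of_isLinearType hf hmin hI σ
    (fun i j => by rw [hσ, hσ]; linear_combination (τ (w i) * τ (w j)) * hε)
    (fun j => τ (f j)) ?_
    (P := C (X i) * map C (g j) - C (X j) * map C (g i)) (e := e)
    ((((hg j).map _).C_mul _).sub (((hg i).map _).C_mul _))
    (by
      rw [map_sub, map_mul, map_mul, aeval_map_C, aeval_map_C, aeval_C, aeval_C]
      exact sub_eq_zero.mpr (hgX i j))
  · have hy (p : MvPolynomial (Fin (n + 1)) k) : aeval (fun j => τ (f j)) p = τ (aeval f p) :=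
      (DFunLike.congr_fun (comp_aeval (R := k) f τ) p).symm
    rw [eval₂_sub, eval₂_mul, eval₂_mul, eval₂_C, eval₂_C, eval₂_map_C, eval₂_map_C, hy, hy] at key
    have h1 (i) : σ.toRingHom (X i) = ε * τ (w i) := hσ i
    rw [h1, h1] at key
    rw [← sub_eq_zero]
    apply hτ
    rw [map_sub, map_mul, map_mul]
    linear_combination key
  · intro a ha
    have hlin (j) : σ (a j) = ε * τ (∑ i, C (coeff (Finsupp.single i 1) (a j)) * w i) := by
      conv_lhs => rw [(ha.1 j).eq_sum_C_mul_X]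
      rw [map_sum, map_sum, Finset.mul_sum]
      refine Finset.sum_congr rfl fun i _ => ?_
      rw [map_mul, map_mul, hσ, ← algebraMap_eq, σ.commutes, τ.commutes]
      ring
    rw [← mul_zero ε, ← map_zero τ, ← hw a ha, map_sum, Finset.mul_sum]
    refine Finset.sum_congr rfl fun j _ => ?_
    rw [hlin, map_mul, mul_assoc]

/-- A vector orthogonal to the Jacobian dual matrix, evaluated at `f`, is proportional to every
tuple of forms in `f` that is proportional to the variables. -/
theorem mul_eq_mul_of_isLinearType {f : Fin (n + 1) → MvPolynomial (Fin (n + 1)) k} {d : ℕ}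
    (hf : ∀ j, (f j).IsHomogeneous d) (hmin : LinearIndependent k f)
    (hI : (baseIdeal f).IsLinearType)
    (w : Fin (n + 1) → MvPolynomial (Fin (n + 1)) k)
    (hw : ∀ a ∈ linearSyzygies f,
      ∑ j, (∑ i, C (coeff (Finsupp.single i 1) (a j)) * w i) * f j = 0)
    {g : Fin (n + 1) → MvPolynomial (Fin (n + 1)) k} {e : ℕ} (hg : ∀ i, (g i).IsHomogeneous e)
    (hgX : ∀ i j, X i * aeval f (g j) = X j * aeval f (g i)) (i j : Fin (n + 1)) :
    w i * aeval f (g j) = w j * aeval f (g i) :=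
  mul_eq_mul_of_thickening (Q := DualNumber (MvPolynomial (Fin (n + 1)) k)) hf hmin hI
    (TrivSqZeroExt.inlAlgHom k _ _) DualNumber.eps DualNumber.eps_mul_eps
    (fun p hp => by simpa using congrArg TrivSqZeroExt.snd hp) w hw hg hgX i j

end RationalMap

/-! ### Ranks, kernels and maximal minors over a domain -/

namespace Matrix

/-- Over a domain, as many columns as the rank are linearly independent, and the others are torsion
modulo their span. -/
theorem exists_linearIndependent_col {R m : Type*} [CommRing R] [IsDomain R] [Finite m] {s : ℕ}
    (A : Matrix m (Fin s) R) :
    ∃ e : Fin A.rank → Fin s, LinearIndependent R (fun j => A.col (e j)) ∧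
      ∀ c, ∃ a : R, a ≠ 0 ∧ a • A.col c ∈ Submodule.span R (Set.range fun j => A.col (e j)) := by
  classical
  obtain ⟨J, hJ, hmax⟩ := exists_maximal_linearIndepOn R A.col
  have htor (c) : ∃ a : R, a ≠ 0 ∧ a • A.col c ∈ Submodule.span R (A.col '' J) := by
    by_cases hc : c ∈ J
    · exact ⟨1, one_ne_zero, by simpa using Submodule.subset_span (Set.mem_image_of_mem _ hc)⟩
    · exact hmax c hc
  choose a ha ha' using htor
  have : Module.Finite R (Submodule.span R (A.col '' J)) :=
    .span_of_finite R (Set.toFinite _)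
  have : Module.Finite R (Submodule.span R (Set.range A.col)) :=
    .span_of_finite R (Set.finite_range _)
  have hle : Submodule.span R (A.col '' J) ≤ Submodule.span R (Set.range A.col) :=
    Submodule.span_mono (Set.image_subset_range _ _)
  have hcard : Fintype.card J = A.rank := by
    rw [rank_eq_finrank_span_cols]
    have h1 : Module.finrank R (Submodule.span R (A.col '' J)) = Fintype.card J := by
      rw [Set.image_eq_range, ← finrank_span_eq_card hJ]
    refine h1 ▸ le_antisymm (Submodule.finrank_mono hle) ?_
    -- One common multiplier for all columns: multiplication by it embeds the whole column span into
    -- the span of the chosen columns, so the two ranks agree.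
    let p : R := ∏ c, a c
    have hp : p ≠ 0 := Finset.prod_ne_zero_iff.mpr fun c _ => ha c
    have hmem : ∀ x ∈ Submodule.span R (Set.range A.col), p • x ∈ Submodule.span R (A.col '' J) := by
      intro x hx
      induction hx using Submodule.span_induction with
      | mem x hx =>
        obtain ⟨c, rfl⟩ := hx
        obtain ⟨b, hb⟩ := Finset.dvd_prod_of_mem a (Finset.mem_univ c)
        rw [show p = b * a c by rw [mul_comm]; exact hb, mul_smul]
        exact Submodule.smul_mem _ _ (ha' c)
      | zero => simp
      | add x y _ _ hx hy => rw [smul_add]; exact add_mem hx hy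
      | smul r x _ hx => rw [smul_comm]; exact Submodule.smul_mem _ _ hx
    refine LinearMap.finrank_le_finrank_of_injective
      (f := ((LinearMap.lsmul R (m → R) p).restrict hmem)) fun x y hxy => ?_
    have := congrArg Subtype.val hxy
    exact Subtype.ext (smul_right_injective (m → R) hp this)
  let e := (Fintype.equivFinOfCardEq hcard).symm
  refine ⟨fun j => (e j : Fin s), hJ.comp e e.injective, fun c => ⟨a c, ha c, ?_⟩⟩
  have : (Set.range fun j => A.col (e j : Fin s)) = A.col '' J := by
    rw [show (fun j => A.col (e j : Fin s)) = (A.col ∘ Subtype.val) ∘ e from rfl,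
      e.surjective.range_comp, Set.range_comp, Subtype.range_coe]
  rw [this]
  exact ha' c

/-- A matrix over a domain with a nonzero vector in its left kernel has not full row rank. -/
theorem rank_lt_of_vecMul_eq_zero {R m l : Type*} [CommRing R] [IsDomain R] [Fintype m]
    [Fintype l] (A : Matrix m l R) {v : m → R} (hv : v ≠ 0) (h : v ᵥ* A = 0) :
    A.rank < Fintype.card m := by
  classical
  rw [← rank_reindex (Equiv.refl m) (Fintype.equivFin l) A]
  set B := reindex (Equiv.refl m) (Fintype.equivFin l) A with hB
  have hvB : v ᵥ* B = 0 := by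
    ext c
    exact congrFun h ((Fintype.equivFin l).symm c)
  refine lt_of_le_of_ne (rank_le_card_height B) fun hr => ?_
  obtain ⟨e, he, -⟩ := B.exists_linearIndependent_col
  let ε : m ≃ Fin B.rank := Fintype.equivFinOfCardEq hr.symm
  have hdet : (of fun a b => B a (e (ε b))).det = 0 := by
    rw [← exists_vecMul_eq_zero_iff]
    exact ⟨v, hv, funext fun b => congrFun hvB (e (ε b))⟩
  obtain ⟨c, hc, hc0⟩ := exists_mulVec_eq_zero_iff.mpr hdet
  refine hc (funext fun b => Fintype.linearIndependent_iff.mp (he.comp ε ε.injective) c ?_ b)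
  ext a
  simpa [mulVec, dotProduct, mul_comm] using congrFun hc0 a

/-- If the left kernel of a matrix with `r` columns over a domain is contained in the multiples of
a vector `x` with a nonzero entry, the matrix has at most `r + 1` rows. -/
theorem card_le_of_vecMul_eq_zero {R m : Type*} [CommRing R] [IsDomain R] [Fintype m] {r : ℕ}
    (A : Matrix m (Fin r) R) {x : m → R} {i : m} (hx : x i ≠ 0)
    (h : ∀ w, w ᵥ* A = 0 → ∀ j, w i * x j = w j * x i) : Fintype.card m ≤ r + 1 := by
  let F : (m → R) →ₗ[R] (Fin r → R) := A.vecMulLinear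
  -- The quotient by the kernel embeds in R^r, and the `i`-th coordinate is injective on the kernel,
  -- which therefore has rank at most one.
  have h1 := (LinearMap.ker F).finrank_quotient_add_finrank
  have h2 := LinearMap.finrank_le_finrank_of_injective (f := (LinearMap.ker F).liftQ F le_rfl)
    (LinearMap.ker_eq_bot.mp (Submodule.ker_liftQ_eq_bot _ _ _ le_rfl))
  have h3 := LinearMap.finrank_le_finrank_of_injective
    (f := (LinearMap.proj i : (m → R) →ₗ[R] R) ∘ₗ (LinearMap.ker F).subtype) (by
      rw [injective_iff_map_eq_zero]
      rintro ⟨w, hw⟩ hwi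
      ext j
      have hwi : w i = 0 := hwi
      have := h w hw j
      rw [hwi, zero_mul, eq_comm, mul_eq_zero] at this
      exact this.resolve_right hx)
  rw [Module.finrank_fin_fun] at h2
  rw [Module.finrank_self] at h3
  rw [Module.finrank_fintype_fun_eq_card] at h1
  omega

/-- Append a column on the right. -/
def appendCol {R m : Type*} {n : ℕ} (A : Matrix m (Fin n) R) (u : m → R) :
    Matrix m (Fin (n + 1)) R :=
  of fun a => Fin.snoc (α := fun _ => R) (A a) (u a)

@[simp]
theorem appendCol_castSucc {R m : Type*} {n : ℕ} (A : Matrix m (Fin n) R) (u : m → R) (a : m)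
    (b : Fin n) : A.appendCol u a b.castSucc = A a b :=
  Fin.snoc_castSucc (α := fun _ => R) _ _ _

@[simp]
theorem appendCol_last {R m : Type*} {n : ℕ} (A : Matrix m (Fin n) R) (u : m → R) (a : m) :
    A.appendCol u a (Fin.last n) = u a :=
  Fin.snoc_last (α := fun _ => R) _ _

/-- The vector of signed maximal minors of a matrix with one column less than rows. -/
def signedMinors {R : Type*} [CommRing R] {n : ℕ} (A : Matrix (Fin (n + 1)) (Fin n) R)
    (i : Fin (n + 1)) : R :=
  (A.appendCol (Pi.single i 1)).det

/-- For B = [A | e_i], the row x B has x_i as its only possibly nonzero entry, in the last place.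
Multiplying by the adjugate gives the identity, since by Cramer's rule the last row of the adjugate
consists of the signed minors of A. -/
theorem mul_signedMinors {R : Type*} [CommRing R] {n : ℕ} (A : Matrix (Fin (n + 1)) (Fin n) R)
    {x : Fin (n + 1) → R} (hx : x ᵥ* A = 0) (i j : Fin (n + 1)) :
    x i * A.signedMinors j = x j * A.signedMinors i := by
  set B := A.appendCol (Pi.single i 1) with hB
  have h1 : x ᵥ* B = Pi.single (Fin.last n) (x i) := by
    ext b
    refine Fin.lastCases ?_ (fun b => ?_) b
    · simp [hB, vecMul, dotProduct, Pi.single_apply]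
    · have := congrFun hx b
      simpa [hB, vecMul, dotProduct] using this
  have h2 := congrFun (congrArg (· ᵥ* B.adjugate) h1) j
  simp only [vecMul_vecMul, mul_adjugate, single_vecMul] at h2
  have h3 : B.adjugate (Fin.last n) j = A.signedMinors j := by
    rw [← transpose_transpose B, ← adjugate_transpose, transpose_apply, adjugate_apply,
      updateRow_transpose, det_transpose, signedMinors]
    congr 1
    ext a b
    refine Fin.lastCases ?_ (fun b => ?_) b
    · simp
    · rw [updateCol_ne (Fin.castSucc_lt_last b).ne]
      simp [hB]
  rw [Pi.smul_apply, row_apply, h3, smul_eq_mul] at h2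
  rw [← h2, signedMinors, ← hB]
  simp [vecMul_smul, mul_comm]

/-- If all minors vanished, each [A | e_i] would kill a nonzero vector, whose last entry is nonzero
because A is injective. So A would reach a nonzero multiple of every e_i, giving n + 1 independent
vectors in R^n. -/
theorem exists_signedMinors_ne_zero {R : Type*} [CommRing R] [IsDomain R] {n : ℕ}
    (A : Matrix (Fin (n + 1)) (Fin n) R) (hA : ∀ c, A *ᵥ c = 0 → c = 0) :
    ∃ i, A.signedMinors i ≠ 0 := by
  by_contra! hall
  have h1 (i) : ∃ c : Fin (n + 1) → R, c ≠ 0 ∧ A.appendCol (Pi.single i 1) *ᵥ c = 0 :=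
    exists_mulVec_eq_zero_iff.mpr (hall i)
  choose c hc hc0 using h1
  have h2 (i) : A *ᵥ (fun b => c i b.castSucc) = fun a =>
      -(Pi.single (M := fun _ => R) i 1 a * c i (Fin.last n)) := by
    ext a
    have := congrFun (hc0 i) a
    rw [mulVec, dotProduct, Fin.sum_univ_castSucc] at this
    simp only [appendCol_castSucc, appendCol_last, Pi.zero_apply] at this
    rw [mulVec, dotProduct]
    exact eq_neg_of_add_eq_zero_left this
  have h3 (i) : c i (Fin.last n) ≠ 0 := by
    intro h0
    have h4 := hA _ (by rw [h2 i, h0]; ext; simp)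
    refine hc i (funext fun b => ?_)
    refine Fin.lastCases h0 (fun b => congrFun h4 b) b
  have hli : LinearIndependent R fun i (b : Fin n) => c i b.castSucc := by
    rw [Fintype.linearIndependent_iff]
    intro t ht i
    have h5 := congrFun (congrArg A.mulVecLin ht) i
    rw [map_sum, map_zero] at h5
    simp only [map_smul, mulVecLin_apply, h2] at h5
    simp only [Finset.sum_apply, Pi.smul_apply, Pi.single_apply, smul_eq_mul] at h5
    simpa [h3 i] using h5
  simpa using hli.fintype_card_le_finrank

theorem map_signedMinors {R S : Type*} [CommRing R] [CommRing S] {n : ℕ}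
    (A : Matrix (Fin (n + 1)) (Fin n) R) (g : R →+* S) (i : Fin (n + 1)) :
    g (A.signedMinors i) = (A.map g).signedMinors i := by
  rw [signedMinors, signedMinors, RingHom.map_det]
  congr 1
  ext a b
  refine Fin.lastCases ?_ (fun b => ?_) b
  · rcases eq_or_ne a i with rfl | h <;> simp [*]
  · simp

theorem isHomogeneous_signedMinors {R σ : Type*} [CommRing R] {n : ℕ}
    (A : Matrix (Fin (n + 1)) (Fin n) (MvPolynomial σ R)) (hA : ∀ a b, (A a b).IsHomogeneous 1)
    (i : Fin (n + 1)) : (A.signedMinors i).IsHomogeneous n := by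
  rw [signedMinors, det_apply]
  refine IsHomogeneous.sum _ _ _ fun τ _ => ?_
  rw [Units.smul_def, ← Int.cast_smul_eq_zsmul R, smul_eq_C_mul]
  refine IsHomogeneous.C_mul ?_ _
  rw [Fin.prod_univ_castSucc]
  have h1 : (∏ b : Fin n, A (τ b.castSucc) b).IsHomogeneous n := by
    simpa using IsHomogeneous.prod Finset.univ (fun b : Fin n => A (τ b.castSucc) b) (fun _ => 1)
      fun b _ => hA _ b
  simp only [appendCol_castSucc, appendCol_last, Pi.single_apply]
  split_ifs
  · simpa using h1
  · simpa using isHomogeneous_zero _ _ n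

end Matrix

/-! ### Factors of forms and common prime divisors -/

namespace MvPolynomial

/-- The coefficients of `p(tX)` as a polynomial in `t` are the homogeneous components of `p`. -/
theorem coeff_aeval_C_X_mul_X {k ι : Type*} [CommRing k] (p : MvPolynomial ι k) (e : ℕ) :
    (aeval (fun i => Polynomial.monomial 1 (X i : MvPolynomial ι k)) p).coeff e =
      homogeneousComponent e p := by
  have h (i : ℕ) : aeval (fun i => Polynomial.monomial 1 (X i : MvPolynomial ι k))
      (homogeneousComponent i p) = Polynomial.monomial i (homogeneousComponent i p) := by
    have h1 := IsHomogeneous.aeval_monomial_one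
      ((homogeneousComponent_isHomogeneous i p).map (algebraMap k (MvPolynomial ι k))) X
    rwa [aeval_map_algebraMap, aeval_map_algebraMap, aeval_X_left_apply] at h1
  conv_lhs => rw [← sum_homogeneousComponent p]
  rw [map_sum, Finset.sum_congr rfl fun i _ => h i, Polynomial.finsetSum_coeff]
  simp only [Polynomial.coeff_monomial, Finset.sum_ite_eq']
  split_ifs with he
  · rfl
  · rw [homogeneousComponent_eq_zero]
    simpa using he

/-- Factors of a nonzero form over a domain are forms. -/
theorem IsHomogeneous.of_mul_left {k ι : Type*} [CommRing k] [IsDomain k] {p q : MvPolynomial ι k}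
    {r : ℕ} (h : (p * q).IsHomogeneous r) (h0 : p * q ≠ 0) : p.IsHomogeneous p.totalDegree := by
  let Φ : MvPolynomial ι k →ₐ[k] Polynomial (MvPolynomial ι k) :=
    MvPolynomial.aeval fun i => Polynomial.monomial 1 (X i)
  have hΦ (p : MvPolynomial ι k) (e : ℕ) : (Φ p).coeff e = homogeneousComponent e p :=
    coeff_aeval_C_X_mul_X p e
  have hne (p : MvPolynomial ι k) (hp : p ≠ 0) : Φ p ≠ 0 := by
    intro h
    refine hp ?_
    rw [← sum_homogeneousComponent p]
    refine Finset.sum_eq_zero fun e _ => ?_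
    rw [← hΦ, h, Polynomial.coeff_zero]
  have hp := hne p (left_ne_zero_of_mul h0)
  have hq := hne q (right_ne_zero_of_mul h0)
  have hpq : Φ p * Φ q = Polynomial.monomial r (p * q) := by
    ext1 e
    rw [← map_mul, hΦ, homogeneousComponent_of_mem h, Polynomial.coeff_monomial]
    simp only [eq_comm]
  -- Highest and lowest exponents of `t` both add under products. They agree for the product, hence
  -- for each factor.
  have h1 := congrArg Polynomial.natDegree hpq
  have h2 := congrArg Polynomial.natTrailingDegree hpq
  rw [Polynomial.natDegree_mul hp hq, Polynomial.natDegree_monomial_eq _ h0] at h1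
  rw [Polynomial.natTrailingDegree_mul hp hq, Polynomial.natTrailingDegree_monomial h0] at h2
  have h3 := Polynomial.natTrailingDegree_le_natDegree (Φ p)
  have h4 := Polynomial.natTrailingDegree_le_natDegree (Φ q)
  have hcomp : homogeneousComponent (Φ p).natDegree p = p := by
    conv_rhs => rw [← sum_homogeneousComponent p]
    rw [eq_comm]
    refine Finset.sum_eq_single _ (fun e _ he => ?_) fun he => ?_
    · rw [← hΦ]
      rcases lt_or_gt_of_ne he with he | he
      · exact Polynomial.coeff_eq_zero_of_lt_natTrailingDegree (by omega)
      · exact Polynomial.coeff_eq_zero_of_natDegree_lt he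
    · rw [homogeneousComponent_eq_zero]
      simpa using he
  have h5 : p.IsHomogeneous (Φ p).natDegree := by
    have := homogeneousComponent_isHomogeneous (Φ p).natDegree p
    rwa [hcomp] at this
  rwa [IsHomogeneous.totalDegree h5 (left_ne_zero_of_mul h0)]

theorem IsHomogeneous.pderiv_eq_C {k ι : Type*} [CommRing k] [Fintype ι] {p : MvPolynomial ι k}
    (hp : p.IsHomogeneous 1) (i : ι) : pderiv i p = C (coeff (Finsupp.single i 1) p) := by
  classical
  conv_lhs => rw [hp.eq_sum_C_mul_X]
  simp [pderiv_X, Pi.single_apply]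

/-- An ideal of height less than two, in a unique factorization domain, with a nonzero element
has a prime divisor. -/
theorem _root_.Ideal.exists_prime_dvd_of_height_lt_two {R : Type*} [CommRing R] [IsDomain R]
    [UniqueFactorizationMonoid R] {I : Ideal R} (hI : I ≠ ⊥) (h : I.height < 2) :
    ∃ p, Prime p ∧ ∀ x ∈ I, p ∣ x := by
  have h1 : I.height = (1 : ℕ) := by
    have h0 := mt Ideal.height_eq_zero_iff_eq_bot.mp hI
    obtain ⟨r, hr⟩ := ENat.ne_top_iff_exists.mp (ne_top_of_lt h)
    rw [← hr] at h h0 ⊢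
    norm_cast at *
    omega
  -- A height-one prime of a factorial domain is principal; its generator is the common divisor.
  obtain ⟨P, hP, hIP, hht⟩ := Ideal.exists_isPrime_height_eq h1
  rw [Nat.cast_one] at hht
  obtain ⟨p, hp, hpp⟩ :=
    Ideal.IsPrime.exists_mem_prime_of_ne_bot hP (Ideal.ne_bot_of_height_eq_one hht)
  have h2 := P.eq_span_singleton_of_height_eq_one hht hp hpp
  exact ⟨p, hpp, fun x hx => Ideal.mem_span_singleton.mp (h2 ▸ hIP hx)⟩

end MvPolynomial

/-! ### The Jacobian dual matrix -/

namespace RationalMap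

open scoped Matrix

variable {k : Type*} [Field k] {n : ℕ}

/-- The Jacobian dual of a matrix `φ` of linear forms: `X · jacobianDual φ = Y · φ`. -/
noncomputable def jacobianDual {s : ℕ}
    (φ : Matrix (Fin (n + 1)) (Fin s) (MvPolynomial (Fin (n + 1)) k)) :
    Matrix (Fin (n + 1)) (Fin s) (MvPolynomial (Fin (n + 1)) k) :=
  Matrix.of fun i c => ∑ j, C (coeff (Finsupp.single i 1) (φ j c)) * X j

section JacobianDual

variable {s : ℕ} {φ : Matrix (Fin (n + 1)) (Fin s) (MvPolynomial (Fin (n + 1)) k)}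
  {f : Fin (n + 1) → MvPolynomial (Fin (n + 1)) k}

theorem aeval_jacobianDual (i : Fin (n + 1)) (c : Fin s) :
    aeval f (jacobianDual φ i c) = ∑ j, C (coeff (Finsupp.single i 1) (φ j c)) * f j := by
  simp [jacobianDual, algebraMap_eq]

theorem isHomogeneous_jacobianDual (i : Fin (n + 1)) (c : Fin s) :
    (jacobianDual φ i c).IsHomogeneous 1 := by
  rw [jacobianDual, Matrix.of_apply]
  exact IsHomogeneous.sum _ _ _ fun _ _ => isHomogeneous_C_mul_X _ _

/-- Each column of linear forms gives a bilinear form in X and f, summed here in the two possible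
orders. -/
theorem X_vecMul_jacobianDual (hφ : ∀ j c, (φ j c).IsHomogeneous 1) :
    X ᵥ* (jacobianDual φ).map (aeval f) = f ᵥ* φ := by
  ext1 c
  simp only [Matrix.vecMul, dotProduct, Matrix.map_apply, aeval_jacobianDual, Finset.mul_sum]
  rw [Finset.sum_comm]
  refine Finset.sum_congr rfl fun j _ => ?_
  conv_rhs => rw [(hφ j c).eq_sum_C_mul_X, Finset.mul_sum]
  exact Finset.sum_congr rfl fun i _ => by ring

/-- The kernel of a matrix of linear syzygies is contained in that of its Jacobian dual. -/
theorem jacobianDual_mulVec_eq_zero (hφ : ∀ j c, (φ j c).IsHomogeneous 1) (hfφ : f ᵥ* φ = 0)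
    {v : Fin s → MvPolynomial (Fin (n + 1)) k} (hv : φ *ᵥ v = 0) :
    (jacobianDual φ).map (aeval f) *ᵥ v = 0 := by
  ext1 i
  -- The Leibniz rule applied to φ v = 0. Pairing with `f` removes the terms with derivatives of
  -- `v`, because f φ = 0.
  have h1 (j) : ∑ c, C (coeff (Finsupp.single i 1) (φ j c)) * v c +
      ∑ c, φ j c * pderiv i (v c) = 0 := by
    have := congrArg (pderiv i) (congrFun hv j)
    simp only [Matrix.mulVec, dotProduct, map_sum, Derivation.leibniz, (hφ _ _).pderiv_eq_C,
      smul_eq_mul, Pi.zero_apply, map_zero, Finset.sum_add_distrib] at this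
    rw [← this, add_comm (∑ c, φ j c * pderiv i (v c))]
    simp only [mul_comm]
  have h2 : ∑ j, f j * ∑ c, φ j c * pderiv i (v c) = 0 := by
    simp only [Finset.mul_sum]
    rw [Finset.sum_comm]
    refine Finset.sum_eq_zero fun c _ => ?_
    have := congrFun hfφ c
    simp only [Matrix.vecMul, dotProduct, Pi.zero_apply] at this
    simp only [← mul_assoc, ← Finset.sum_mul, this, zero_mul]
  calc ((jacobianDual φ).map (aeval f) *ᵥ v) i
      = ∑ j, f j * ∑ c, C (coeff (Finsupp.single i 1) (φ j c)) * v c := by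
        simp only [Matrix.mulVec, dotProduct, Matrix.map_apply, aeval_jacobianDual,
          Finset.mul_sum, Finset.sum_mul]
        rw [Finset.sum_comm]
        exact Finset.sum_congr rfl fun j _ => Finset.sum_congr rfl fun c _ => by ring
    _ = ∑ j, f j * (∑ c, C (coeff (Finsupp.single i 1) (φ j c)) * v c +
          ∑ c, φ j c * pderiv i (v c)) := by
        simp only [mul_add, Finset.sum_add_distrib, h2, add_zero]
    _ = 0 := by simp only [h1, mul_zero, Finset.sum_const_zero]

/-- The kernel of the Jacobian dual is mapped by `f` to the kernel of the matrix. -/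
theorem mulVec_aeval_eq_zero (hφ : ∀ j c, (φ j c).IsHomogeneous 1) (hfφ : f ᵥ* φ = 0)
    {v : Fin s → MvPolynomial (Fin (n + 1)) k} (hv : jacobianDual φ *ᵥ v = 0) :
    φ *ᵥ (fun c => aeval f (v c)) = 0 := by
  ext1 j
  -- The same argument with X and Y exchanged: differentiate in Y_j, substitute `f`, then pair with
  -- X, which annihilates the evaluated Jacobian dual.
  have h1 (i) : ∑ c, C (coeff (Finsupp.single i 1) (φ j c)) * aeval f (v c) +
      ∑ c, aeval f (jacobianDual φ i c) * aeval f (pderiv j (v c)) = 0 := by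
    have hd (c) : pderiv j (jacobianDual φ i c) = C (coeff (Finsupp.single i 1) (φ j c)) := by
      simp [jacobianDual, pderiv_X, Pi.single_apply]
    have := congrArg (fun p => aeval f (pderiv j p)) (congrFun hv i)
    simp only [Matrix.mulVec, dotProduct, map_sum, Derivation.leibniz, hd,
      smul_eq_mul, Pi.zero_apply, map_zero, Finset.sum_add_distrib, map_add, map_mul,
      aeval_C, algebraMap_eq] at this
    rw [← this, add_comm (∑ c, aeval f (jacobianDual φ i c) * aeval f (pderiv j (v c)))]
    simp only [mul_comm]
  have h2 : ∑ i, X i * ∑ c, aeval f (jacobianDual φ i c) * aeval f (pderiv j (v c)) = 0 := by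
    simp only [Finset.mul_sum]
    rw [Finset.sum_comm]
    refine Finset.sum_eq_zero fun c _ => ?_
    have := congrFun ((X_vecMul_jacobianDual hφ).trans hfφ) c
    simp only [Matrix.vecMul, dotProduct, Pi.zero_apply, Matrix.map_apply] at this
    simp only [← mul_assoc, ← Finset.sum_mul, this, zero_mul]
  calc (φ *ᵥ fun c => aeval f (v c)) j
      = ∑ i, X i * ∑ c, C (coeff (Finsupp.single i 1) (φ j c)) * aeval f (v c) := by
        simp only [Matrix.mulVec, dotProduct, Finset.mul_sum]
        rw [Finset.sum_comm]
        refine Finset.sum_congr rfl fun c _ => ?_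
        conv_lhs => rw [(hφ j c).eq_sum_C_mul_X, Finset.sum_mul]
        exact Finset.sum_congr rfl fun i _ => by ring
    _ = ∑ i, X i * (∑ c, C (coeff (Finsupp.single i 1) (φ j c)) * aeval f (v c) +
          ∑ c, aeval f (jacobianDual φ i c) * aeval f (pderiv j (v c))) := by
        simp only [mul_add, Finset.sum_add_distrib, h2, add_zero]
    _ = 0 := by simp only [h1, mul_zero, Finset.sum_const_zero]

end JacobianDual

end RationalMap

/-! ### Birationality and the rank of the linear syzygies -/

namespace RationalMap

open scoped Matrix

variable {k : Type*} [Field k] {n : ℕ}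

theorem mul_eq_mul_of_equivalent_X {h : Fin (n + 1) → MvPolynomial (Fin (n + 1)) k}
    (hX : Equivalent h X) (i j : Fin (n + 1)) : X i * h j = X j * h i := by
  obtain ⟨F, F', -, -, -, -, -, hF', hh⟩ := hX
  apply mul_left_cancel₀ hF'
  linear_combination X j * hh i - X i * hh j

theorem ne_zero_of_equivalent_X {h : Fin (n + 1) → MvPolynomial (Fin (n + 1)) k}
    (hX : Equivalent h X) (i : Fin (n + 1)) : h i ≠ 0 := by
  obtain ⟨F, F', -, -, -, -, hF, -, hh⟩ := hX
  exact right_ne_zero_of_mul (hh i ▸ mul_ne_zero hF (X_ne_zero i))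

section Matrix

variable {s : ℕ} {f : Fin (n + 1) → MvPolynomial (Fin (n + 1)) k}
  {φ : Matrix (Fin (n + 1)) (Fin s) (MvPolynomial (Fin (n + 1)) k)}

theorem IsLinearSyzygyMatrix.isHomogeneous (h : IsLinearSyzygyMatrix f φ) (j : Fin (n + 1))
    (c : Fin s) : (φ j c).IsHomogeneous 1 :=
  (h.le (Submodule.subset_span ⟨c, rfl⟩) : φ.col c ∈ linearSyzygies f).1 j

theorem IsLinearSyzygyMatrix.vecMul_eq_zero (h : IsLinearSyzygyMatrix f φ) : f ᵥ* φ = 0 := by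
  ext1 c
  have := (h.le (Submodule.subset_span ⟨c, rfl⟩) : φ.col c ∈ linearSyzygies f).2
  rw [Pi.zero_apply, ← this]
  simp [Matrix.vecMul, dotProduct, mul_comm]

/-- The left kernel of the Jacobian dual, in terms of all linear syzygies. -/
theorem IsLinearSyzygyMatrix.sum_eq_zero (h : IsLinearSyzygyMatrix f φ)
    {w : Fin (n + 1) → MvPolynomial (Fin (n + 1)) k}
    (hw : w ᵥ* (jacobianDual φ).map (aeval f) = 0)
    (a : Fin (n + 1) → MvPolynomial (Fin (n + 1)) k) (ha : a ∈ linearSyzygies f) :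
    ∑ j, (∑ i, C (coeff (Finsupp.single i 1) (a j)) * w i) * f j = 0 := by
  rw [← h] at ha
  induction ha using Submodule.span_induction with
  | mem a ha =>
    obtain ⟨c, rfl⟩ := ha
    have := congrFun hw c
    simp only [Matrix.vecMul, dotProduct, Matrix.map_apply, aeval_jacobianDual,
      Finset.mul_sum, Pi.zero_apply] at this
    rw [← this, Finset.sum_comm]
    simp only [Finset.sum_mul, Matrix.col_apply]
    exact Finset.sum_congr rfl fun j _ => Finset.sum_congr rfl fun i _ => by ring
  | zero => simp
  | add a b _ _ ha hb =>
    simp only [Pi.add_apply, coeff_add, map_add, add_mul, Finset.sum_add_distrib, ha, hb, add_zero]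
  | smul c a _ ha =>
    simp only [Pi.smul_apply, coeff_smul, smul_eq_mul, map_mul, mul_assoc]
    simp only [← Finset.mul_sum, mul_assoc, ha, mul_zero]

theorem IsLinearSyzygyMatrix.rank_le (h : IsLinearSyzygyMatrix f φ) (hf : f ≠ 0) : φ.rank ≤ n := by
  have := φ.rank_lt_of_vecMul_eq_zero hf h.vecMul_eq_zero
  rw [Fintype.card_fin] at this
  omega

/-- If a map of linear type is birational, its linear syzygies have maximal rank. -/
theorem IsLinearSyzygyMatrix.le_rank (h : IsLinearSyzygyMatrix f φ) {d : ℕ}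
    (hf : ∀ j, (f j).IsHomogeneous d) (hmin : LinearIndependent k f)
    (hI : (baseIdeal f).IsLinearType) {g : Fin (n + 1) → MvPolynomial (Fin (n + 1)) k}
    (hg : IsInverse f g) : n ≤ φ.rank := by
  obtain ⟨e, -, he⟩ := φ.exists_linearIndependent_col
  obtain ⟨⟨r, hr⟩, hgX⟩ := hg
  set ψ := (jacobianDual φ).map (aeval f) with hψ
  -- Only rank-many columns of ψ are kept, with g(f) as the vector spanning the left kernel up to
  -- proportionality.
  have hcard := Matrix.card_le_of_vecMul_eq_zero (ψ.submatrix id e)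
    (ne_zero_of_equivalent_X hgX 0) fun w hw j => ?_
  · rw [Fintype.card_fin] at hcard
    omega
  refine mul_eq_mul_of_isLinearType hf hmin hI w (h.sum_eq_zero ?_) hr.isHomogeneous
    (mul_eq_mul_of_equivalent_X hgX) 0 j
  ext1 c
  obtain ⟨a, ha, hmem⟩ := he c
  obtain ⟨b, hb⟩ := Submodule.mem_span_range_iff_exists_fun _ |>.mp hmem
  -- The dependence of column `c` on the chosen columns, read as a kernel vector of `φ`, passes to
  -- ψ. Hence `w`, orthogonal to the chosen columns of ψ, is orthogonal to all of them.
  have hv : φ *ᵥ (∑ j, b j • Pi.single (e j) 1 - a • Pi.single c 1) = 0 := by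
    rw [Matrix.mulVec_sub, Matrix.mulVec_sum]
    simp only [Matrix.mulVec_smul, Matrix.mulVec_single_one]
    rw [hb, sub_self]
  have h1 := congrArg (w ⬝ᵥ ·)
    (jacobianDual_mulVec_eq_zero h.isHomogeneous h.vecMul_eq_zero hv)
  simp only [Matrix.dotProduct_mulVec, ← hψ, dotProduct_sub, dotProduct_sum, dotProduct_smul,
    dotProduct_single_one, dotProduct_zero, smul_eq_mul] at h1
  have h2 (j) : (w ᵥ* ψ) (e j) = 0 := congrFun hw j
  simp only [h2, mul_zero, Finset.sum_const_zero, zero_sub, neg_eq_zero, mul_eq_zero] at h1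
  exact h1.resolve_left ha

/-- A matrix of linear forms, of rank `n` and orthogonal to `f`, yields an inverse of degree
`n`. -/
theorem exists_isDatum_of_rank_eq (hφ : ∀ j c, (φ j c).IsHomogeneous 1) (hfφ : f ᵥ* φ = 0)
    (hf : AlgebraicIndependent k f) (hn : 1 ≤ n) (hr : φ.rank = n) :
    ∃ G : Fin (n + 1) → MvPolynomial (Fin (n + 1)) k, IsDatum G n ∧
      ∀ i j, X i * aeval f (G j) = X j * aeval f (G i) := by
  obtain ⟨e, he⟩ : ∃ e : Fin n → Fin s,
      LinearIndependent (MvPolynomial (Fin (n + 1)) k) fun j => φ.col (e j) := by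
    obtain ⟨e, he, -⟩ := φ.exists_linearIndependent_col
    exact ⟨e ∘ Fin.cast hr.symm, he.comp _ (Fin.cast_injective _)⟩
  let φ' := φ.submatrix id e
  have hφ' (j c) : (φ' j c).IsHomogeneous 1 := hφ j (e c)
  have hfφ' : f ᵥ* φ' = 0 := funext fun c => congrFun hfφ (e c)
  have hinj := algebraicIndependent_iff_injective_aeval.mp hf
  refine ⟨(jacobianDual φ').signedMinors, ⟨hn, ?_, ?_⟩, fun i j => ?_⟩
  · exact Matrix.isHomogeneous_signedMinors _ isHomogeneous_jacobianDual
  -- A kernel vector over k[Y] becomes, after substituting `f`, a relation among independent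
  -- columns. So it vanishes at `f`, and then identically by algebraic independence.
  · refine Matrix.exists_signedMinors_ne_zero _ fun v hv => ?_
    have h1 := mulVec_aeval_eq_zero hφ' hfφ' hv
    ext1 b
    apply hinj
    rw [Pi.zero_apply, map_zero]
    refine Fintype.linearIndependent_iff.mp he (fun c => aeval f (v c)) ?_ b
    ext1 a
    simpa [Matrix.mulVec, dotProduct, mul_comm, φ'] using congrFun h1 a
  · have hmap (i) : aeval f ((jacobianDual φ').signedMinors i) =
        ((jacobianDual φ').map (aeval f)).signedMinors i :=
      Matrix.map_signedMinors _ (aeval f : _ →ₐ[k] MvPolynomial (Fin (n + 1)) k).toRingHom i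
    rw [hmap, hmap]
    exact Matrix.mul_signedMinors _ ((X_vecMul_jacobianDual hφ').trans hfφ') i j

end Matrix

/-! ### Representatives of the inverse and its degree -/

theorem IsDatum.isInverse {f g : Fin (n + 1) → MvPolynomial (Fin (n + 1)) k} {d r : ℕ}
    (hf : ∀ j, (f j).IsHomogeneous d) (hdom : IsDominant f) (hg : IsDatum g r)
    (h : ∀ i j, X i * aeval f (g j) = X j * aeval f (g i)) : IsInverse f g := by
  obtain ⟨i, hi⟩ := hg.exists_ne_zero
  refine ⟨⟨r, hg⟩, aeval f (g i), X i, d * r, 1, (hg.isHomogeneous i).aeval f hf,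
    isHomogeneous_X _ _, ?_, X_ne_zero i, fun j => ?_⟩
  · rwa [Ne, map_eq_zero_iff _ (algebraicIndependent_iff_injective_aeval.mp hdom)]
  · rw [mul_comm, ← h i j]
    rfl

/-- Two representatives of the inverse map are proportional. -/
theorem equivalent_of_isInverse {f g g' : Fin (n + 1) → MvPolynomial (Fin (n + 1)) k}
    (hdom : IsDominant f) {r : ℕ} (hg : IsInverse f g) (hg' : IsDatum g' r)
    (h : ∀ i j, X i * aeval f (g' j) = X j * aeval f (g' i)) : Equivalent g g' := by
  have hgX := mul_eq_mul_of_equivalent_X hg.2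
  -- After substituting `f`, both tuples are proportional to X; injectivity of the substitution
  -- brings the proportionality back to k[Y].
  have hcross (i j) : g i * g' j = g j * g' i := by
    apply algebraicIndependent_iff_injective_aeval.mp hdom
    apply mul_left_cancel₀ (mul_ne_zero (X_ne_zero (R := k) i) (X_ne_zero (R := k) j))
    simp only [comp] at hgX
    rw [map_mul, map_mul]
    linear_combination X j * aeval f (g i) * h i j - X j * aeval f (g' i) * hgX i j
  obtain ⟨⟨e, he⟩, -⟩ := hg
  obtain ⟨i, hi⟩ := he.exists_ne_zero
  refine ⟨g i, g' i, e, r, he.isHomogeneous i, hg'.isHomogeneous i, hi, fun h0 => ?_, fun j => ?_⟩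
  · obtain ⟨j, hj⟩ := hg'.exists_ne_zero
    have := hcross i j
    rw [h0, mul_zero, mul_eq_zero] at this
    exact this.elim hi hj
  · rw [hcross, mul_comm]

/-- A representative of the inverse map is not proportional to a tuple of constants. -/
theorem not_equivalent_const {f g : Fin (n + 1) → MvPolynomial (Fin (n + 1)) k} (hn : 1 ≤ n)
    (hg : IsInverse f g) {F F' : MvPolynomial (Fin (n + 1)) k} {c : Fin (n + 1) → k}
    (hF' : F' ≠ 0) (hF : F ≠ 0) (h : ∀ j, F * C (c j) = F' * g j) : False := by
  have hgX := mul_eq_mul_of_equivalent_X hg.2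
  have hcross (i j) : g i * C (c j) = g j * C (c i) := by
    apply mul_left_cancel₀ (mul_ne_zero hF' hF)
    linear_combination F' * g i * h j - F' * g j * h i
  have hX (i j : Fin (n + 1)) : (X i : MvPolynomial (Fin (n + 1)) k) * C (c j) = X j * C (c i) := by
    have h1 := congrArg (aeval f) (hcross i j)
    rw [map_mul, map_mul, aeval_C, aeval_C] at h1
    simp only [algebraMap_eq] at h1
    have h2 := hgX i j
    simp only [comp] at h2
    apply mul_left_cancel₀ (ne_zero_of_equivalent_X hg.2 i)
    simp only [comp]
    linear_combination X i * h1 + C (c i) * h2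
  -- Comparing coefficients of X_i needs a second index, hence n ≥ 1.
  have hc (j) : c j = 0 := by
    have : Nontrivial (Fin (n + 1)) := Fin.nontrivial_iff_two_le.mpr (by omega)
    obtain ⟨i, hij⟩ := exists_ne j
    have := congrArg (coeff (Finsupp.single i 1)) (hX i j)
    rw [mul_comm, coeff_C_mul, mul_comm (X j), coeff_C_mul] at this
    simpa [ coeff_X, Finsupp.single_left_inj, hij.symm] using this
  obtain ⟨⟨e, he⟩, -⟩ := hg
  obtain ⟨i, hi⟩ := he.exists_ne_zero
  have := h i
  rw [hc, map_zero, mul_zero, eq_comm, mul_eq_zero] at this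
  exact this.elim hF' hi

/-- Dividing a representative by a common prime factor lowers its degree. -/
theorem exists_lt_of_prime_dvd {f g g' : Fin (n + 1) → MvPolynomial (Fin (n + 1)) k} (hn : 1 ≤ n)
    (hg : IsInverse f g) {r : ℕ} (hg' : IsDatum g' r) (hgg' : Equivalent g g')
    {p : MvPolynomial (Fin (n + 1)) k} (hp : Prime p) (hdvd : ∀ j, p ∣ g' j) :
    ∃ r' < r, ∃ g'', IsDatum g'' r' ∧ Equivalent g g'' := by
  choose q hq using hdvd
  obtain ⟨i, hi⟩ := hg'.exists_ne_zero
  have hph : p.IsHomogeneous p.totalDegree :=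
    IsHomogeneous.of_mul_left (hq i ▸ hg'.isHomogeneous i) (hq i ▸ hi)
  have hdeg (j) (hj : q j ≠ 0) :
      (q j).IsHomogeneous (q j).totalDegree ∧ p.totalDegree + (q j).totalDegree = r := by
    have h0 : p * q j ≠ 0 := mul_ne_zero hp.ne_zero hj
    have hj' := hq j ▸ hg'.isHomogeneous j
    refine ⟨IsHomogeneous.of_mul_left (mul_comm p _ ▸ hj') (mul_comm p _ ▸ h0), ?_⟩
    rw [← totalDegree_mul_of_isDomain hp.ne_zero hj, hj'.totalDegree h0]
  have hqi : q i ≠ 0 := right_ne_zero_of_mul (hq i ▸ hi)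
  have hqh (j) : (q j).IsHomogeneous (q i).totalDegree := by
    by_cases hj : q j = 0
    · rw [hj]
      exact isHomogeneous_zero _ _ _
    · have h1 := hdeg j hj
      have h2 := (hdeg i hqi).2
      rw [show (q i).totalDegree = (q j).totalDegree by omega]
      exact h1.1
  obtain ⟨F, F', a, b, hFa, hFb, hF, hF', hFF⟩ := hgg'
  have hpos : p.totalDegree ≠ 0 := by
    intro h0
    rw [totalDegree_eq_zero_iff_eq_C] at h0
    apply hp.not_isUnit
    rw [h0]
    refine (IsUnit.mk0 _ fun h1 => hp.ne_zero ?_).map C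
    rw [h0, h1, map_zero]
  have hFq (j) : F * p * q j = F' * g j := by rw [mul_assoc, ← hq, hFF]
  refine ⟨(q i).totalDegree, by have := (hdeg i hqi).2; omega, q, ⟨?_, hqh, i, hqi⟩, F * p, F', _, b,
    hFa.mul hph, hFb, mul_ne_zero hF hp.ne_zero, hF', hFq⟩
  -- Degree zero would make the quotient tuple constant, which an inverse cannot be.
  rw [Nat.one_le_iff_ne_zero]
  intro h0
  have hC (j) : q j = C (coeff 0 (q j)) := by
    rw [← totalDegree_eq_zero_iff_eq_C, ← Nat.le_zero, ← h0]
    exact (hqh j).totalDegree_le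
  exact not_equivalent_const hn hg hF' (mul_ne_zero hF hp.ne_zero) (c := fun j => coeff 0 (q j))
    fun j => by rw [← hC, hFq]

/-- The degree of the inverse map is at most that of any of its representatives. -/
theorem exists_hasDegree_le {f g g' : Fin (n + 1) → MvPolynomial (Fin (n + 1)) k} (hn : 1 ≤ n)
    (hg : IsInverse f g) {r : ℕ} (hg' : IsDatum g' r) (hgg' : Equivalent g g') :
    ∃ r' ≤ r, HasDegree g r' := by
  classical
  -- A representative of least degree is chosen; codimension below two would give a common prime
  -- factor and so a smaller degree.
  have hex : ∃ r, ∃ g', IsDatum g' r ∧ Equivalent g g' := ⟨r, g', hg', hgg'⟩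
  obtain ⟨g₀, h₀, hgg₀⟩ := Nat.find_spec hex
  refine ⟨Nat.find hex, Nat.find_min' hex ⟨g', hg', hgg'⟩, g₀, h₀, hgg₀, ?_⟩
  by_contra! hlt
  obtain ⟨p, hp, hdvd⟩ := Ideal.exists_prime_dvd_of_height_lt_two (I := baseIdeal g₀) (by
    obtain ⟨j, hj⟩ := h₀.exists_ne_zero
    have hmem : g₀ j ∈ baseIdeal g₀ := Ideal.subset_span (Set.mem_range_self j)
    exact fun hbot => hj ((Submodule.mem_bot _).mp (hbot ▸ hmem))) hlt
  obtain ⟨r', hr', h⟩ := exists_lt_of_prime_dvd hn hg h₀ hgg₀ hp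
    fun j => hdvd _ (Ideal.subset_span (Set.mem_range_self j))
  exact Nat.find_min hex hr' h

end RationalMap

theorem mainTheorem6 {k : Type*} [Field k] {n d s : ℕ} (hn : 1 ≤ n)
    (f : Fin (n + 1) → MvPolynomial (Fin (n + 1)) k)
    (hf : RationalMap.IsDatum f d)
    (hmin : LinearIndependent k f)
    (hI : (RationalMap.baseIdeal f).IsLinearType)
    (φ₁ : Matrix (Fin (n + 1)) (Fin s) (MvPolynomial (Fin (n + 1)) k))
    (hφ₁ : RationalMap.IsLinearSyzygyMatrix f φ₁) :
    (RationalMap.IsCremona f ↔ φ₁.rank = n) ∧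
      (RationalMap.IsCremona f →
        ∀ g : Fin (n + 1) → MvPolynomial (Fin (n + 1)) k, RationalMap.IsInverse f g →
          ∃ r ≤ n, RationalMap.HasDegree g r) := by
  have hdom : RationalMap.IsDominant f :=
    RationalMap.algebraicIndependent_of_isLinearType hf hmin hI
  have hf0 : f ≠ 0 := fun h => hmin.ne_zero 0 (congrFun h 0)
  have hrank (g) (hg : RationalMap.IsInverse f g) : φ₁.rank = n :=
    le_antisymm (hφ₁.rank_le hf0) (hφ₁.le_rank hf.isHomogeneous hmin hI hg)
  have hinv := RationalMap.exists_isDatum_of_rank_eq hφ₁.isHomogeneous hφ₁.vecMul_eq_zero hdom hn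
  refine ⟨⟨fun ⟨_, g, hg⟩ => hrank g hg, fun hr => ?_⟩, fun _ g hg => ?_⟩
  · obtain ⟨G, hG, hGX⟩ := hinv hr
    exact ⟨hdom, G, hG.isInverse hf.isHomogeneous hdom hGX⟩
  · obtain ⟨G, hG, hGX⟩ := hinv (hrank g hg)
    exact RationalMap.exists_hasDegree_le hn hg hG
      (RationalMap.equivalent_of_isInverse hdom hg hG hGX)
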